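/- **Theorem (Extension theorem).** Let $V$ be a vector space over a field $\mathbb F$ of characteristic $0$. A quantum field on $V$ is a series $a(z)=\sum_{n\in\mathbb Z}a_{(n)}z^{-n-1}$ with $a_{(n)}\in\operatorname{End}V$ such that for every $v\in V$ one has $a_{(n)}v=0$ for all sufficiently large $n$. Two quantum fields $a(z),b(z)$ are a local pair if $(z-w)^N[a(z),b(w)]=0$ for some integer $N\ge 0$. For $n\in\mathbb Z$ their $n$-th product is $$a(w)_{(n)}b(w)=\operatorname{Res}_z\big(a(z)b(w)\,i_{z,w}(z-w)^n-b(w)a(z)\,i_{w,z}(z-w)^n\big),$$ where $i_{z,w}$ and $i_{w,z}$ denote expansion in the domains $|z|>|w|$ and $|z|<|w|$ respectively. Let $(V,|0\rangle,T,\mathcal F)$ be a pre-vertex algebra, that is: $|0\rangle\in V$ is a non-zero vector, $T\in\operatorname{End}V$, and $\mathcal F=\{a^j(z)\}_{j\in J}$ is a family of quantum fields on $V$ such that 1. $T|0\rangle=0$; 2. $[T,a^j(z)]=\partial_z a^j(z)$ for all $j\in J$; 3. $a^i(z),a^j(z)$ is a local pair for all $i,j\in J$ (including $i=j$); 4. the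 vectors $a^{j_1}_{(n_1)}\cdots a^{j_s}_{(n_s)}|0\rangle$ ($s\ge 0$, $j_i\in J$, $n_i\in\mathbb Z$) span $V$. Let $\mathcal F_{\min}$ be the span of all quantum fields $a^{j_1}(z)_{(n_1)}\big(a^{j_2}(z)_{(n_2)}\cdots\big(a^{j_s}(z)_{(n_s)}I_V\big)\cdots\big)$ ($s\ge 0$, $j_i\in J$, $n_i\in\mathbb Z$), where $I_V$ is the constant identity field, and let $\mathcal F_{\max}$ be the set of all quantum fields $a(z)$ with $[T,a(z)]=\partial_z a(z)$ such that $a(z),a^j(z)$ is a local pair for all $j\in J$. Then: (a) $\mathcal F_{\min}=\mathcal F_{\max}$. (b) For every $a(z)\in\mathcal F_{\max}$ one has $a(z)|0\rangle\in V[[z]]$, and the map $\mathit{fs}\colon\mathcal F_{\max}\to V$, $a(z)\mapsto a(z)|0\rangle|_{z=0}$, is bijective. (c) The inverse map $\mathit{sf}=\mathit{fs}^{-1}$, written $a\mapsto a(z)$, is linear and makes $V$ a vertex algebra with vacuum vector $|0\rangle$ and translation operator $T$: one has $|0\rangle(z)=I_V$, and for all $a,b\in V$, $$a(z)|0\rangle=a+(Ta)z+\cdots\in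 V[[z]],\qquad [T,a(z)]=\partial_z a(z),\qquad a(z),b(z)\text{ is a local pair}.$$ Equivalently, the $z$-product $a(z)b:=\mathit{sf}(a)b$ is local and has unit $|0\rangle$, and it satisfies $T(a(z)b)=(Ta)(z)b+a(z)Tb$ and $(Ta)(z)=\partial_z a(z)$ for all $a,b\in V$. This structure extends the given data: $\mathit{sf}(\mathit{fs}(a^j(z)))=a^j(z)$ for every $j\in J$. -/

import Mathlib

open scoped VertexOperator

/-!
Quantum fields. Mathlib's `VertexOperator 𝔽 V` is the type of `𝔽`-linear maps `V → V((z))`, that is,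
of `End V`-valued quantum fields `a(z) = ∑ₙ a₍ₙ₎ z⁻ⁿ⁻¹` (for every `v`, `a₍ₙ₎ v = 0` for large `n`).
The Fourier coefficient `a₍ₙ₎` is `A[[n]]`.
-/

namespace QuantumField

variable {𝔽 V : Type*} [Field 𝔽] [AddCommGroup V] [Module 𝔽 V]

theorem exists_ncoeff_eq_zero (A : VertexOperator 𝔽 V) (v : V) :
    ∃ N : ℤ, ∀ n : ℤ, N ≤ n → (A[[n]]) v = 0 :=
  ⟨-(HahnSeries.order ((HahnModule.of 𝔽).symm (A v))), fun n hn =>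
    VertexOperator.ncoeff_eq_zero_of_lt_order A n v (by omega)⟩

/-- The quantum field with prescribed Fourier coefficients `c n = a₍ₙ₎`. -/
noncomputable def ofNCoeff (c : ℤ → Module.End 𝔽 V)
    (hc : ∀ v, ∃ N : ℤ, ∀ n : ℤ, N ≤ n → c n v = 0) : VertexOperator 𝔽 V :=
  VertexOperator.of_coeff (fun k => c (-k - 1)) (by
    intro v
    obtain ⟨N, hN⟩ := hc v
    refine ⟨-N, fun k hk => ?_⟩
    by_contra h
    exact hk (hN _ (by omega)))

theorem ncoeff_ofNCoeff (c : ℤ → Module.End 𝔽 V)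
    (hc : ∀ v, ∃ N : ℤ, ∀ n : ℤ, N ≤ n → c n v = 0) (n : ℤ) :
    (ofNCoeff c hc)[[n]] = c n := by
  rw [ofNCoeff, VertexOperator.ncoeff_of_coeff]
  congr 1
  ring

/-- The constant field `I_V`. -/
noncomputable def idField (𝔽 V : Type*) [Field 𝔽] [AddCommGroup V] [Module 𝔽 V] :
    VertexOperator 𝔽 V :=
  ofNCoeff (fun n => if n = -1 then LinearMap.id else 0)
    (fun v => ⟨0, fun n hn => by rw [if_neg (by omega)]; rfl⟩)

/-- Translation covariance `[T, a(z)] = ∂_z a(z)`, i.e. `[T, a₍ₙ₎] = -n a₍ₙ₋₁₎` for all `n`. -/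
def IsTranslationCovariant (T : Module.End 𝔽 V) (A : VertexOperator 𝔽 V) : Prop :=
  ∀ n : ℤ, ⁅T, A[[n]]⁆ = (-n) • A[[n - 1]]

/-- Multiplication by `z - w` of a formal distribution `∑ c m n z⁻ᵐ⁻¹ w⁻ⁿ⁻¹` in two variables. -/
def mulZSubW {U : Type*} [AddCommGroup U] (c : ℤ → ℤ → U) : ℤ → ℤ → U :=
  fun m n => c (m + 1) n - c m (n + 1)

/-- Locality of a pair: `(z - w)^N [a(z), b(w)] = 0` for some `N ≥ 0`. -/
def IsLocalPair (A B : VertexOperator 𝔽 V) : Prop :=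
  ∃ N : ℕ, mulZSubW^[N] (fun m n => ⁅A[[m]], B[[n]]⁆) = 0

/-- The `j`-th summand of the `m`-th Fourier coefficient of the `n`-th product `a(w)₍ₙ₎ b(w)`. -/
noncomputable def nthProdTerm (A : VertexOperator 𝔽 V) (n : ℤ) (B : VertexOperator 𝔽 V)
    (m : ℤ) (j : ℕ) : Module.End 𝔽 V :=
  ((-1 : ℤ) ^ j * Ring.choose n j) •
    (A[[n - j]] * B[[m + j]] - n.negOnePow • (B[[m + n - j]] * A[[(j : ℤ)]]))

theorem nthProdTerm_finite_support (A : VertexOperator 𝔽 V) (n : ℤ) (B : VertexOperator 𝔽 V)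
    (m : ℤ) (v : V) : (Function.support fun j => nthProdTerm A n B m j v).Finite := by
  obtain ⟨K, hK⟩ := exists_ncoeff_eq_zero A v
  obtain ⟨L, hL⟩ := exists_ncoeff_eq_zero B v
  refine (Set.finite_Iio (K.toNat + (L - m).toNat)).subset fun j hj => ?_
  by_contra h
  simp only [Set.mem_Iio, not_lt] at h
  apply hj
  simp [nthProdTerm, hK (j : ℤ) (by omega), hL (m + j) (by omega)]

/-- The `m`-th Fourier coefficient of `a(w)₍ₙ₎ b(w)`. -/
noncomputable def nthProdCoeff (A : VertexOperator 𝔽 V) (n : ℤ) (B : VertexOperator 𝔽 V)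
    (m : ℤ) : Module.End 𝔽 V where
  toFun v := ∑ᶠ j : ℕ, nthProdTerm A n B m j v
  map_add' u v := by
    simp only [map_add]
    exact finsum_add_distrib (nthProdTerm_finite_support A n B m u)
      (nthProdTerm_finite_support A n B m v)
  map_smul' r v := by
    simp only [map_smul, RingHom.id_apply]
    exact (smul_finsum' r (nthProdTerm_finite_support A n B m v)).symm

theorem nthProdCoeff_eq_zero (A : VertexOperator 𝔽 V) (n : ℤ) (B : VertexOperator 𝔽 V) (v : V) :
    ∃ N : ℤ, ∀ m : ℤ, N ≤ m → nthProdCoeff A n B m v = 0 := by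
  obtain ⟨K, hK⟩ := exists_ncoeff_eq_zero A v
  obtain ⟨L, hL⟩ := exists_ncoeff_eq_zero B v
  choose M hM using fun j : ℕ => exists_ncoeff_eq_zero B ((A[[(j : ℤ)]]) v)
  obtain ⟨S, hS⟩ : ∃ S : ℤ, ∀ j ∈ Finset.range K.toNat, M j ≤ S := by
    obtain ⟨S, hS⟩ := ((Finset.range K.toNat).image M).bddAbove
    exact ⟨S, fun j hj => hS (by simpa using ⟨j, by simpa using hj, rfl⟩)⟩
  refine ⟨max L (S - n + K.toNat), fun m hm => ?_⟩
  have h0 : ∀ j : ℕ, nthProdTerm A n B m j v = 0 := by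
    intro j
    have h1 : (B[[m + j]]) v = 0 := hL _ (by omega)
    have h2 : (B[[m + n - j]]) ((A[[(j : ℤ)]]) v) = 0 := by
      by_cases hj : j < K.toNat
      · exact hM j _ (by have := hS j (by simpa using hj); omega)
      · rw [hK (j : ℤ) (by omega), map_zero]
    simp [nthProdTerm, h1, h2]
  simp [nthProdCoeff, h0]

/-- The `n`-th product of quantum fields, `n ∈ ℤ`:
`a(w)₍ₙ₎ b(w) = Res_z (a(z) b(w) i_{z,w} (z-w)ⁿ - b(w) a(z) i_{w,z} (z-w)ⁿ)`, where
`i_{z,w} (z-w)ⁿ = ∑_{j ≥ 0} (-1)ʲ (n choose j) zⁿ⁻ʲ wʲ` and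
`i_{w,z} (z-w)ⁿ = ∑_{j ≥ 0} (-1)ⁿ⁻ʲ (n choose j) wⁿ⁻ʲ zʲ`. -/
noncomputable def nthProd (A : VertexOperator 𝔽 V) (n : ℤ) (B : VertexOperator 𝔽 V) :
    VertexOperator 𝔽 V :=
  ofNCoeff (nthProdCoeff A n B) (nthProdCoeff_eq_zero A n B)

/-- The field-state map `a(z) ↦ a(z)|0⟩|_{z=0}`: the coefficient of `z⁰` of `a(z)|0⟩`. -/
noncomputable def fieldState (vac : V) (A : VertexOperator 𝔽 V) : V :=
  (A[[-1]]) vac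

end QuantumField

open QuantumField

/-- A pre-vertex algebra on the vector space `V`, with fields indexed by `J`. -/
structure PreVertexAlgebra (𝔽 V J : Type*) [Field 𝔽] [AddCommGroup V] [Module 𝔽 V] where
  /-- the vacuum vector -/
  vac : V
  vac_ne_zero : vac ≠ 0
  /-- the translation operator -/
  T : Module.End 𝔽 V
  /-- the family of quantum fields -/
  field : J → VertexOperator 𝔽 V
  vacuum : T vac = 0
  translation_covariance : ∀ j, IsTranslationCovariant T (field j)
  locality : ∀ i j, IsLocalPair (field i) (field j)
  /-- The vectors `a^{j₁}₍ₙ₁₎ ⋯ a^{jₛ}₍ₙₛ₎ |0⟩`, `s ≥ 0`, span `V`. -/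
  completeness : Submodule.span 𝔽 (Set.range fun l : List (J × ℤ) =>
    l.foldr (fun p v => ((field p.1)[[p.2]]) v) vac) = ⊤

namespace PreVertexAlgebra

variable {𝔽 V J : Type*} [Field 𝔽] [AddCommGroup V] [Module 𝔽 V]

/-- The span of all `a^{j₁}(z)₍ₙ₁₎(a^{j₂}(z)₍ₙ₂₎ ⋯ (a^{jₛ}(z)₍ₙₛ₎ I_V)⋯)`, `s ≥ 0`. -/
noncomputable def Fmin (P : PreVertexAlgebra 𝔽 V J) : Submodule 𝔽 (VertexOperator 𝔽 V) :=
  Submodule.span 𝔽 (Set.range fun l : List (J × ℤ) =>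
    l.foldr (fun p B => nthProd (P.field p.1) p.2 B) (idField 𝔽 V))

/-- The translation covariant quantum fields that are local with every field of the family. -/
def Fmax (P : PreVertexAlgebra 𝔽 V J) : Set (VertexOperator 𝔽 V) :=
  {A | IsTranslationCovariant P.T A ∧ ∀ j, IsLocalPair A (P.field j)}

/-- The field-state map on `Fmax`. -/
noncomputable def fs (P : PreVertexAlgebra 𝔽 V J) (A : P.Fmax) : V :=
  fieldState P.vac (A : VertexOperator 𝔽 V)

end PreVertexAlgebra

/-- Vertex algebra in the language of fields: a linear state-field correspondence `a ↦ Y a = a(z)`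
with the vacuum, translation covariance and locality axioms. -/
structure IsVertexAlgebra {𝔽 V : Type*} [Field 𝔽] [AddCommGroup V] [Module 𝔽 V]
    (vac : V) (T : Module.End 𝔽 V) (Y : V →ₗ[𝔽] VertexOperator 𝔽 V) : Prop where
  vac_ne_zero : vac ≠ 0
  /-- `|0⟩(z) = I_V` -/
  vacuum_field : Y vac = idField 𝔽 V
  /-- `a(z)|0⟩ = a + (Ta) z + ⋯` -/
  creation_regular : ∀ a : V, ∀ n : ℤ, 0 ≤ n → ((Y a)[[n]]) vac = 0
  creation_zero : ∀ a : V, ((Y a)[[-1]]) vac = a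
  creation_one : ∀ a : V, ((Y a)[[-2]]) vac = T a
  translation_covariance : ∀ a : V, IsTranslationCovariant T (Y a)
  locality : ∀ a b : V, IsLocalPair (Y a) (Y b)

/-- Vertex algebra in the language of differential algebra: a local unital `z`-algebra, with the
bilinear `z`-product `a(z)b = Y a b ∈ V((z))`, derivation `T` and unit element `e`. -/
structure IsLocalUnitalZAlgebra {𝔽 V : Type*} [Field 𝔽] [AddCommGroup V] [Module 𝔽 V]
    (e : V) (T : Module.End 𝔽 V) (Y : V →ₗ[𝔽] VertexOperator 𝔽 V) : Prop where
  /-- `T(a(z)b) = (Ta)(z)b + a(z)Tb` -/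
  derivation : ∀ (a b : V) (n : ℤ),
    T (((Y a)[[n]]) b) = ((Y (T a))[[n]]) b + ((Y a)[[n]]) (T b)
  /-- `(Ta)(z) = ∂_z a(z)` -/
  consistency : ∀ (a : V) (n : ℤ), (Y (T a))[[n]] = (-n) • (Y a)[[n - 1]]
  unit_ne_zero : e ≠ 0
  /-- `e(z)a = a` -/
  unit_left : Y e = idField 𝔽 V
  /-- `a(z)e = a mod z V[[z]]` -/
  unit_right_regular : ∀ a : V, ∀ n : ℤ, 0 ≤ n → ((Y a)[[n]]) e = 0
  unit_right_zero : ∀ a : V, ((Y a)[[-1]]) e = a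
  locality : ∀ a b : V, IsLocalPair (Y a) (Y b)

/-! Covariance and `T|0⟩ = 0` give `T a₍ₙ₎|0⟩ = -n a₍ₙ₋₁₎|0⟩`. In characteristic 0 this forces
`a(z)|0⟩ ∈ V[[z]]` and determines the whole series from its constant term.

Injectivity of `fs` on `Fmax` (`eq_zero_of_fieldState_eq_zero`): a field with zero state kills
`|0⟩`. Being local with the generators, it kills every vector they produce from `|0⟩`, hence all of
`V`.

Surjectivity already on `Fmin` (`fieldState_foldr_nthProd`): `fs` turns the product by `a^j(z)₍ₙ₎`
into the action of `a^j₍ₙ₎`, so the spanning fields of `Fmin` go to the spanning vectors of `V`.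
Dong's lemma (`IsLocalPair.nthProd`) and covariance of products give `Fmin ⊆ Fmax`, and the two
spaces coincide.

Dong's lemma applied once more makes all these fields mutually local. The remaining axioms compare
two fields of `Fmax` with the same state. -/

namespace QuantumField

/-! ### Formal distributions and multiplication by `z - w` -/

section Distributions

variable {U W : Type*} [AddCommGroup U] [AddCommGroup W]

/-- `mulZSubW` as an additive endomorphism. -/
def mulZSubWHom (U : Type*) [AddCommGroup U] : (ℤ → ℤ → U) →+ (ℤ → ℤ → U) where
  toFun := mulZSubW
  map_zero' := by ext; simp [mulZSubW]
  map_add' c d := by ext; simp only [mulZSubW, Pi.add_apply]; abel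

theorem mulZSubW_iterate_zero (N : ℕ) : mulZSubW^[N] (0 : ℤ → ℤ → U) = 0 :=
  iterate_map_zero (mulZSubWHom U) N

theorem mulZSubW_iterate_add (N : ℕ) (c d : ℤ → ℤ → U) :
    mulZSubW^[N] (c + d) = mulZSubW^[N] c + mulZSubW^[N] d :=
  iterate_map_add (mulZSubWHom U) N c d

theorem mulZSubW_iterate_sub (N : ℕ) (c d : ℤ → ℤ → U) :
    mulZSubW^[N] (c - d) = mulZSubW^[N] c - mulZSubW^[N] d :=
  iterate_map_sub (mulZSubWHom U) N c d

theorem mulZSubW_iterate_eq_zero_of_le {c : ℤ → ℤ → U} {M N : ℕ} (h : M ≤ N)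
    (hc : mulZSubW^[M] c = 0) : mulZSubW^[N] c = 0 := by
  obtain ⟨k, rfl⟩ := Nat.exists_eq_add_of_le' h
  rw [Function.iterate_add_apply, hc, mulZSubW_iterate_zero]

theorem mulZSubW_iterate_map (φ : U →+ W) (N : ℕ) (c : ℤ → ℤ → U) :
    mulZSubW^[N] (fun m n => φ (c m n)) = fun m n => φ (mulZSubW^[N] c m n) := by
  induction N generalizing c with
  | zero => rfl
  | succ N ih =>
    rw [Function.iterate_succ_apply, Function.iterate_succ_apply, ← ih]
    congr 1
    ext m n
    simp [mulZSubW]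

theorem mulZSubW_iterate_map_eq_zero (φ : U →+ W) {N : ℕ} {c : ℤ → ℤ → U}
    (hc : mulZSubW^[N] c = 0) : mulZSubW^[N] (fun m n => φ (c m n)) = 0 := by
  rw [mulZSubW_iterate_map, hc]
  ext
  simp

theorem mulZSubW_iterate_swap (N : ℕ) (c : ℤ → ℤ → U) :
    mulZSubW^[N] (fun m n => c n m) = fun m n => (-1 : ℤ) ^ N • mulZSubW^[N] c n m := by
  induction N generalizing c with
  | zero => simp
  | succ N ih =>
    have h : mulZSubW (fun m n => c n m) = fun m n => (-mulZSubW c) n m := by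
      ext m n
      simp [mulZSubW]
    rw [Function.iterate_succ_apply, h, ih, Function.iterate_succ_apply]
    ext m n
    rw [show mulZSubW^[N] (-mulZSubW c) = -mulZSubW^[N] (mulZSubW c) from
      iterate_map_neg (mulZSubWHom U) N _]
    simp [pow_succ]

/-- `z - w` is not a zero divisor on distributions whose powers of `w` are bounded below. -/
theorem eq_zero_of_mulZSubW_iterate {c : ℤ → ℤ → U} {L : ℤ} (hL : ∀ m n, L ≤ n → c m n = 0)
    {N : ℕ} (h : mulZSubW^[N] c = 0) : c = 0 := by
  induction N generalizing c with
  | zero => exact h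
  | succ N ih =>
    have h1 : mulZSubW c = 0 := ih
      (fun m n hn => by rw [mulZSubW, hL _ _ hn, hL _ _ (by omega), sub_zero]) h
    have h2 : ∀ m n, c (m + 1) n = c m (n + 1) := fun m n =>
      sub_eq_zero.1 (congrFun (congrFun h1 m) n)
    -- `(z - w)c = 0` makes `c` constant along the lines `m + n = const`, and each line reaches the
    -- range `n ≥ L` where `c` vanishes.
    have h3 : ∀ (k : ℕ) m n, c m n = c (m - k) (n + k) := by
      intro k
      induction k with
      | zero => simp
      | succ k ihk =>
        intro m n
        rw [ihk, show m - (k : ℤ) = (m - (k + 1 : ℕ)) + 1 by push_cast; ring, h2]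
        push_cast
        ring_nf
    ext m n
    rw [h3 (L - n).toNat, hL _ _ (by omega)]
    rfl

/-- The effect of `∂_z` on `(z - w)`-torsion. -/
theorem mulZSubW_iterate_deriv {N : ℕ} {c : ℤ → ℤ → U} (hc : mulZSubW^[N] c = 0) :
    mulZSubW^[N + 1] (fun m n => (-m) • c (m - 1) n) = 0 := by
  induction N generalizing c with
  | zero =>
    rw [show c = 0 from hc]
    ext
    simp [mulZSubW]
  | succ N ih =>
    -- Leibniz rule: `(z - w)∂_z c = ∂_z((z - w)c) - c`.
    have h : mulZSubW (fun m n => (-m) • c (m - 1) n)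
        = (fun m n => (-m) • mulZSubW c (m - 1) n) - c := by
      ext m n
      simp only [mulZSubW, Pi.sub_apply, add_sub_cancel_right, sub_add_cancel]
      module
    rw [Function.iterate_succ_apply, h, mulZSubW_iterate_sub, ih hc, hc, sub_zero]

end Distributions

/-! ### Alternating binomial sums -/

section BinomialSums

variable {U : Type*} [AddCommGroup U]

/-- The coefficients of `(1 - x)ⁿ`. -/
noncomputable def binomCoeff (n : ℤ) (j : ℕ) : ℤ := (-1) ^ j * Ring.choose n j

theorem binomCoeff_zero_right (n : ℤ) : binomCoeff n 0 = 1 := by simp [binomCoeff]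

theorem binomCoeff_zero_succ (j : ℕ) : binomCoeff 0 (j + 1) = 0 := by
  simp [binomCoeff, Ring.choose_zero_succ]

theorem binomCoeff_succ_succ (n : ℤ) (j : ℕ) :
    binomCoeff (n + 1) (j + 1) = binomCoeff n (j + 1) - binomCoeff n j := by
  rw [binomCoeff, binomCoeff, binomCoeff, Ring.choose_succ_succ]
  ring

/-- Compare coefficients in `(1 - x) d/dx (1 - x)ⁿ = -n (1 - x)ⁿ`. -/
theorem binomCoeff_mul_sub (n : ℤ) (j : ℕ) :
    binomCoeff n j * (n - j) = -(binomCoeff n (j + 1) * (j + 1 : ℕ)) := by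
  have h := Ring.choose_smul_choose n (Nat.le_succ j)
  simp only [Nat.succ_eq_add_one, Nat.choose_succ_self_right, Nat.add_sub_cancel_left,
    Ring.choose_one_right, nsmul_eq_mul] at h
  rw [binomCoeff, binomCoeff, mul_assoc, ← h]
  ring

/-- The sum `∑ⱼ (-1)ʲ (n choose j) gⱼ`. -/
noncomputable def binomSum (n : ℤ) (g : ℕ → U) : U := ∑ᶠ j, binomCoeff n j • g j

theorem finsum_eq_sum_range {t : ℕ → U} {K : ℕ} (h : ∀ j, K ≤ j → t j = 0) :
    ∑ᶠ j, t j = ∑ j ∈ Finset.range K, t j := by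
  refine finsum_eq_sum_of_support_subset _ fun j hj => ?_
  by_contra hjK
  exact hj (h j (by simpa using hjK))

theorem binomSum_eq_sum (n : ℤ) {g : ℕ → U} {K : ℕ} (h : ∀ j, K ≤ j → g j = 0) :
    binomSum n g = ∑ j ∈ Finset.range K, binomCoeff n j • g j :=
  finsum_eq_sum_range fun j hj => by rw [h j hj, smul_zero]

theorem binomSum_zero_left (g : ℕ → U) : binomSum 0 g = g 0 := by
  rw [binomSum, finsum_eq_single _ 0]
  · simp [binomCoeff_zero_right]
  · rintro (_ | j) hj
    · exact absurd rfl hj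
    · rw [binomCoeff_zero_succ, zero_smul]

theorem binomSum_zero_right (n : ℤ) : binomSum n (fun _ => (0 : U)) = 0 := by simp [binomSum]

theorem binomSum_eq_apply_zero (n : ℤ) {g : ℕ → U} (h : ∀ j, g (j + 1) = 0) :
    binomSum n g = g 0 := by
  rw [binomSum_eq_sum (K := 1) n]
  · simp [binomCoeff_zero_right]
  · rintro (_ | j) hj
    · omega
    · exact h j

/-- A `finsum` with infinite support takes the default value 0, so additivity is claimed only for
eventually vanishing sequences. -/
theorem binomSum_add (n : ℤ) {g h : ℕ → U} (hg : ∀ᶠ j in Filter.atTop, g j = 0)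
    (hh : ∀ᶠ j in Filter.atTop, h j = 0) :
    binomSum n (fun j => g j + h j) = binomSum n g + binomSum n h := by
  obtain ⟨K, hK⟩ := Filter.eventually_atTop.1 (hg.and hh)
  rw [binomSum_eq_sum n fun j hj => (hK j hj).1, binomSum_eq_sum n fun j hj => (hK j hj).2,
    binomSum_eq_sum (K := K) n fun j hj => by rw [(hK j hj).1, (hK j hj).2, add_zero],
    ← Finset.sum_add_distrib]
  simp

theorem binomSum_zsmul (n k : ℤ) {g : ℕ → U} (hg : ∀ᶠ j in Filter.atTop, g j = 0) :
    binomSum n (fun j => k • g j) = k • binomSum n g := by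
  obtain ⟨K, hK⟩ := Filter.eventually_atTop.1 hg
  rw [binomSum_eq_sum n hK, binomSum_eq_sum (K := K) n fun j hj => by rw [hK j hj, smul_zero],
    Finset.smul_sum]
  exact Finset.sum_congr rfl fun j _ => smul_comm _ _ _

theorem binomSum_sub (n : ℤ) {g h : ℕ → U} (hg : ∀ᶠ j in Filter.atTop, g j = 0)
    (hh : ∀ᶠ j in Filter.atTop, h j = 0) :
    binomSum n (fun j => g j - h j) = binomSum n g - binomSum n h := by
  have := binomSum_add n hg (h := fun j => (-1 : ℤ) • h j) (hh.mono fun j hj => by simp [hj])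
  rw [binomSum_zsmul n (-1) hh] at this
  simpa [sub_eq_add_neg] using this

theorem map_binomSum {W : Type*} [AddCommGroup W] (φ : U →+ W) (n : ℤ) {g : ℕ → U}
    (hg : ∀ᶠ j in Filter.atTop, g j = 0) :
    φ (binomSum n g) = binomSum n (fun j => φ (g j)) := by
  obtain ⟨K, hK⟩ := Filter.eventually_atTop.1 hg
  rw [binomSum_eq_sum n hK, binomSum_eq_sum (K := K) n fun j hj => by rw [hK j hj, map_zero] ]
  simp

theorem eventually_succ {g : ℕ → U} (hg : ∀ᶠ j in Filter.atTop, g j = 0) :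
    ∀ᶠ j in Filter.atTop, g (j + 1) = 0 :=
  (Filter.tendsto_add_atTop_nat 1).eventually hg

/-- Pascal's rule. -/
theorem binomSum_succ (n : ℤ) {g : ℕ → U} (hg : ∀ᶠ j in Filter.atTop, g j = 0) :
    binomSum (n + 1) g = binomSum n g - binomSum n (fun j => g (j + 1)) := by
  obtain ⟨K, hK⟩ := Filter.eventually_atTop.1 hg
  have hK' : ∀ j, K + 1 ≤ j → g j = 0 := fun j hj => hK j (by omega)
  rw [binomSum_eq_sum _ hK', binomSum_eq_sum n hK',
    binomSum_eq_sum (K := K) n fun j hj => hK (j + 1) (by omega),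
    Finset.sum_range_succ', Finset.sum_range_succ' (fun j => binomCoeff n j • g j)]
  simp only [binomCoeff_succ_succ, sub_smul, Finset.sum_sub_distrib, binomCoeff_zero_right]
  abel

/-- Differentiation of `(1 - x)ⁿ`. -/
theorem binomSum_sub_smul_succ (n : ℤ) {g : ℕ → U} (hg : ∀ᶠ j in Filter.atTop, g j = 0) :
    binomSum n (fun j => (n - j) • g (j + 1)) = -binomSum n (fun j => (j : ℤ) • g j) := by
  obtain ⟨K, hK⟩ := Filter.eventually_atTop.1 hg
  rw [binomSum_eq_sum (K := K + 1) n (g := fun j => (j : ℤ) • g j)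
      fun j hj => by rw [hK j (by omega), smul_zero],
    binomSum_eq_sum (K := K) n fun j hj => by rw [hK (j + 1) (by omega), smul_zero],
    Finset.sum_range_succ', ← sub_eq_zero]
  simp only [smul_smul, binomCoeff_mul_sub]
  simp

/-- Coefficient form of `(∂_z + ∂_w)(z - w)ⁿ = 0`, with `g j` in the place of `zⁿ⁻ʲ wʲ⁻¹`. -/
theorem binomSum_sub_deriv (n : ℤ) {x g : ℕ → U} (hx : ∀ᶠ j in Filter.atTop, x j = 0)
    (hg : ∀ᶠ j in Filter.atTop, g j = 0) :
    binomSum n (fun j => x j - ((j : ℤ) • g j + (n - j) • g (j + 1))) = binomSum n x := by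
  have h1 : ∀ᶠ j : ℕ in Filter.atTop, (j : ℤ) • g j = 0 :=
    hg.mono fun j hj => by rw [hj, smul_zero]
  have h2 : ∀ᶠ j : ℕ in Filter.atTop, (n - j) • g (j + 1) = 0 :=
    (eventually_succ hg).mono fun j hj => by rw [hj, smul_zero]
  rw [binomSum_sub n hx (by filter_upwards [h1, h2] with j h1 h2 using by rw [h1, h2, add_zero]),
    binomSum_add n h1 h2, binomSum_sub_smul_succ n hg, add_neg_cancel, sub_zero]

end BinomialSums

/-! ### The residue of a pair of distributions in three variables -/

section Residue

variable {U : Type*} [AddCommGroup U]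

/-- Multiplication by `z - w` in the variables `z, w, u`. -/
def mul12 (U : Type*) [AddCommGroup U] : (ℤ → ℤ → ℤ → U) →+ (ℤ → ℤ → ℤ → U) where
  toFun f p q r := f (p + 1) q r - f p (q + 1) r
  map_zero' := by ext; simp
  map_add' f g := by ext; simp only [Pi.add_apply]; abel

/-- Multiplication by `z - u` in the variables `z, w, u`. -/
def mul13 (U : Type*) [AddCommGroup U] : (ℤ → ℤ → ℤ → U) →+ (ℤ → ℤ → ℤ → U) where
  toFun f p q r := f (p + 1) q r - f p q (r + 1)
  map_zero' := by ext; simp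
  map_add' f g := by ext; simp only [Pi.add_apply]; abel

/-- Multiplication by `w - u` in the variables `z, w, u`. -/
def mul23 (U : Type*) [AddCommGroup U] : (ℤ → ℤ → ℤ → U) →+ (ℤ → ℤ → ℤ → U) where
  toFun f p q r := f p (q + 1) r - f p q (r + 1)
  map_zero' := by ext; simp
  map_add' f g := by ext; simp only [Pi.add_apply]; abel

theorem mul12_apply (f : ℤ → ℤ → ℤ → U) (p q r : ℤ) :
    mul12 U f p q r = f (p + 1) q r - f p (q + 1) r := rfl

theorem mul13_apply (f : ℤ → ℤ → ℤ → U) (p q r : ℤ) :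
    mul13 U f p q r = f (p + 1) q r - f p q (r + 1) := rfl

theorem mul23_apply (f : ℤ → ℤ → ℤ → U) (p q r : ℤ) :
    mul23 U f p q r = f p (q + 1) r - f p q (r + 1) := rfl

/-- The identity `w - u = (z - u) - (z - w)` is what drives Dong's lemma. -/
theorem mul23_eq (f : ℤ → ℤ → ℤ → U) : mul23 U f = mul13 U f - mul12 U f := by
  ext
  simp [mul12_apply, mul13_apply, mul23_apply]

theorem commute_mul12_mul13 : Function.Commute (mul12 U) (mul13 U) := fun f => by
  ext
  simp only [mul12_apply, mul13_apply]
  abel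

theorem commute_mul12_mul23 : Function.Commute (mul12 U) (mul23 U) := fun f => by
  ext
  simp only [mul12_apply, mul23_apply]
  abel

theorem commute_mul13_mul23 : Function.Commute (mul13 U) (mul23 U) := fun f => by
  ext
  simp only [mul13_apply, mul23_apply]
  abel

theorem mul12_iterate_apply (N : ℕ) (f : ℤ → ℤ → ℤ → U) (p q r : ℤ) :
    (mul12 U)^[N] f p q r = mulZSubW^[N] (fun p q => f p q r) p q := by
  induction N generalizing f with
  | zero => rfl
  | succ N ih => rw [Function.iterate_succ_apply, ih, Function.iterate_succ_apply]; rfl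

theorem mul13_iterate_apply (N : ℕ) (f : ℤ → ℤ → ℤ → U) (p q r : ℤ) :
    (mul13 U)^[N] f p q r = mulZSubW^[N] (fun p r => f p q r) p r := by
  induction N generalizing f with
  | zero => rfl
  | succ N ih => rw [Function.iterate_succ_apply, ih, Function.iterate_succ_apply]; rfl

theorem mul23_iterate_apply (N : ℕ) (f : ℤ → ℤ → ℤ → U) (p q r : ℤ) :
    (mul23 U)^[N] f p q r = mulZSubW^[N] (fun q r => f p q r) q r := by
  induction N generalizing f with
  | zero => rfl
  | succ N ih => rw [Function.iterate_succ_apply, ih, Function.iterate_succ_apply]; rfl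

/-- For each power of `u`, the powers of `w` are bounded below. -/
def BoundedSnd (f : ℤ → ℤ → ℤ → U) : Prop := ∀ r, ∃ L : ℤ, ∀ p q, L ≤ q → f p q r = 0

/-- For each power of `u`, the powers of `z` are bounded below. -/
def BoundedFst (f : ℤ → ℤ → ℤ → U) : Prop := ∀ r, ∃ K : ℤ, ∀ p q, K ≤ p → f p q r = 0

theorem BoundedSnd.mul12 {f : ℤ → ℤ → ℤ → U} (h : BoundedSnd f) : BoundedSnd (mul12 U f) := by
  intro r
  obtain ⟨L, hL⟩ := h r
  exact ⟨L, fun p q hq => by rw [mul12_apply, hL _ _ hq, hL _ _ (by omega), sub_zero]⟩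

theorem BoundedFst.mul12 {f : ℤ → ℤ → ℤ → U} (h : BoundedFst f) : BoundedFst (mul12 U f) := by
  intro r
  obtain ⟨L, hL⟩ := h r
  exact ⟨L, fun p q hq => by rw [mul12_apply, hL _ _ hq, hL _ _ (by omega), sub_zero]⟩

theorem BoundedSnd.mul13 {f : ℤ → ℤ → ℤ → U} (h : BoundedSnd f) : BoundedSnd (mul13 U f) := by
  intro r
  obtain ⟨L, hL⟩ := h r
  obtain ⟨L', hL'⟩ := h (r + 1)
  exact ⟨max L L', fun p q hq => by
    rw [mul13_apply, hL _ _ (by omega), hL' _ _ (by omega), sub_zero]⟩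

theorem BoundedFst.mul13 {f : ℤ → ℤ → ℤ → U} (h : BoundedFst f) : BoundedFst (mul13 U f) := by
  intro r
  obtain ⟨L, hL⟩ := h r
  obtain ⟨L', hL'⟩ := h (r + 1)
  exact ⟨max L L', fun p q hq => by
    rw [mul13_apply, hL _ _ (by omega), hL' _ _ (by omega), sub_zero]⟩

theorem BoundedSnd.sub {f g : ℤ → ℤ → ℤ → U} (hf : BoundedSnd f) (hg : BoundedSnd g) :
    BoundedSnd (f - g) := by
  intro r
  obtain ⟨L, hL⟩ := hf r
  obtain ⟨L', hL'⟩ := hg r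
  exact ⟨max L L', fun p q hq => by
    simp [hL p q (by omega), hL' p q (by omega)]⟩

theorem BoundedFst.sub {f g : ℤ → ℤ → ℤ → U} (hf : BoundedFst f) (hg : BoundedFst g) :
    BoundedFst (f - g) := by
  intro r
  obtain ⟨L, hL⟩ := hf r
  obtain ⟨L', hL'⟩ := hg r
  exact ⟨max L L', fun p q hq => by
    simp [hL p q (by omega), hL' p q (by omega)]⟩

theorem BoundedSnd.mul23_iterate {f : ℤ → ℤ → ℤ → U} (h : BoundedSnd f) (N : ℕ) :
    BoundedSnd ((mul23 U)^[N] f) := by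
  induction N generalizing f with
  | zero => exact h
  | succ N ih =>
    rw [Function.iterate_succ_apply]
    exact ih (by rw [mul23_eq]; exact h.mul13.sub h.mul12)

theorem BoundedFst.mul23_iterate {f : ℤ → ℤ → ℤ → U} (h : BoundedFst f) (N : ℕ) :
    BoundedFst ((mul23 U)^[N] f) := by
  induction N generalizing f with
  | zero => exact h
  | succ N ih =>
    rw [Function.iterate_succ_apply]
    exact ih (by rw [mul23_eq]; exact h.mul13.sub h.mul12)

theorem BoundedSnd.eventually {f : ℤ → ℤ → ℤ → U} (h : BoundedSnd f) (n m r : ℤ) :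
    ∀ᶠ j : ℕ in Filter.atTop, f (n - j) (m + j) r = 0 := by
  obtain ⟨L, hL⟩ := h r
  filter_upwards [Filter.eventually_ge_atTop (L - m).toNat] with j hj
  exact hL _ _ (by omega)

theorem BoundedFst.eventually {f : ℤ → ℤ → ℤ → U} (h : BoundedFst f) (k r : ℤ) :
    ∀ᶠ j : ℕ in Filter.atTop, f j (k - j) r = 0 := by
  obtain ⟨L, hL⟩ := h r
  filter_upwards [Filter.eventually_ge_atTop L.toNat] with j hj
  exact hL _ _ (by omega)

/-- `Res_z (F i_{z,w} (z-w)ⁿ - F' i_{w,z} (z-w)ⁿ)`. -/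
noncomputable def residue (n : ℤ) (F F' : ℤ → ℤ → ℤ → U) (m r : ℤ) : U :=
  binomSum n (fun j => F (n - j) (m + j) r)
    - (n.negOnePow : ℤ) • binomSum n (fun j => F' j (m + n - j) r)

theorem residue_zero (n : ℤ) : residue n (0 : ℤ → ℤ → ℤ → U) 0 = 0 := by
  ext
  simp [residue, binomSum_zero_right]

theorem residue_sub (n : ℤ) {F F' G G' : ℤ → ℤ → ℤ → U} (hF : BoundedSnd F)
    (hF' : BoundedFst F') (hG : BoundedSnd G) (hG' : BoundedFst G') :
    residue n (F - G) (F' - G') = residue n F F' - residue n G G' := by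
  ext m r
  simp only [residue, Pi.sub_apply]
  rw [binomSum_sub n (hF.eventually n m r) (hG.eventually n m r),
    binomSum_sub n (hF'.eventually (m + n) r) (hG'.eventually (m + n) r), smul_sub]
  abel

/-- Both expansions satisfy `(z - w)(z - w)ⁿ = (z - w)ⁿ⁺¹`. By Pascal's rule, the sign from the
expansion in `|z| < |w|` is absorbed by `n.negOnePow`. -/
theorem residue_mul12 (n : ℤ) {F F' : ℤ → ℤ → ℤ → U} (hF : BoundedSnd F)
    (hF' : BoundedFst F') : residue n (mul12 U F) (mul12 U F') = residue (n + 1) F F' := by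
  ext m r
  have h1 := hF.eventually (n + 1) m r
  have h2 := hF'.eventually (m + (n + 1)) r
  have e1 : (fun j : ℕ => mul12 U F (n - j) (m + j) r) = fun j : ℕ =>
      F (n + 1 - j) (m + j) r - F (n + 1 - (j + 1 : ℕ)) (m + (j + 1 : ℕ)) r := by
    ext j
    rw [mul12_apply]
    push_cast
    ring_nf
  have e2 : (fun j : ℕ => mul12 U F' j (m + n - j) r) = fun j : ℕ =>
      F' (j + 1 : ℕ) (m + (n + 1) - (j + 1 : ℕ)) r - F' j (m + (n + 1) - j) r := by
    ext j
    rw [mul12_apply]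
    push_cast
    ring_nf
  rw [residue, residue, e1, e2, binomSum_sub n h1 (eventually_succ h1),
    binomSum_sub n (eventually_succ h2) h2, binomSum_succ n h1, binomSum_succ n h2,
    Int.negOnePow_succ, Units.val_neg]
  module

/-- `w - u` does not involve `z`, so it passes through `Res_z`. -/
theorem mulZSubW_residue (n : ℤ) {F F' : ℤ → ℤ → ℤ → U} (hF : BoundedSnd F)
    (hF' : BoundedFst F') :
    mulZSubW (residue n F F') = residue n (mul23 U F) (mul23 U F') := by
  ext m r
  have e1 : ∀ j : ℕ, m + j + 1 = m + 1 + (j : ℤ) := fun j => by ring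
  have e2 : ∀ j : ℕ, m + n - j + 1 = m + 1 + n - (j : ℤ) := fun j => by ring
  simp only [residue, mul23_apply, mulZSubW, e1, e2]
  rw [binomSum_sub n (hF.eventually n (m + 1) r) (hF.eventually n m (r + 1)),
    binomSum_sub n (hF'.eventually (m + 1 + n) r) (hF'.eventually (m + n) (r + 1)), smul_sub]
  abel

theorem mulZSubW_iterate_residue (n : ℤ) {F F' : ℤ → ℤ → ℤ → U} (hF : BoundedSnd F)
    (hF' : BoundedFst F') (N : ℕ) :
    mulZSubW^[N] (residue n F F') = residue n ((mul23 U)^[N] F) ((mul23 U)^[N] F') := by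
  induction N with
  | zero => rfl
  | succ N ih =>
    rw [Function.iterate_succ_apply', ih,
      mulZSubW_residue n (hF.mul23_iterate N) (hF'.mul23_iterate N),
      Function.iterate_succ_apply', Function.iterate_succ_apply']

/-- For `n ≥ 0` both expansions are the same polynomial, so this is `Res_z (z - w)ⁿ(F - F')`; the
index 0 extracts the residue. -/
theorem residue_natCast (n : ℕ) {F F' : ℤ → ℤ → ℤ → U} (hF : BoundedSnd F)
    (hF' : BoundedFst F') (m r : ℤ) :
    residue n F F' m r = (mul12 U)^[n] F 0 m r - (mul12 U)^[n] F' 0 m r := by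
  induction n generalizing F F' with
  | zero => simp [residue, binomSum_zero_left]
  | succ n ih =>
    rw [Nat.cast_succ, ← residue_mul12 _ hF hF', ih hF.mul12 hF'.mul12]
    rfl

/-- Each factor `w - u = (z - u) - (z - w)` either uses up one of the `j` powers of `z - u` or
raises `n` by 1, so `j + (s - n)⁺` drops. At `j = 0` both distributions vanish; at `n ≥ s` the
residue involves `(z - w)ⁿ(F - F') = 0`. -/
theorem mulZSubW_iterate_residue_eq_zero (s : ℕ) (k : ℕ) :
    ∀ (j : ℕ) (n : ℤ) {F F' : ℤ → ℤ → ℤ → U}, BoundedSnd F → BoundedFst F' →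
      (mul13 U)^[j] F = 0 → (mul13 U)^[j] F' = 0 → (mul12 U)^[s] F = (mul12 U)^[s] F' →
      j + (s - n).toNat ≤ k → mulZSubW^[k] (residue n F F') = 0 := by
  induction k with
  | zero =>
    intro j n F F' _ _ h h' _ hk
    obtain rfl : j = 0 := by omega
    obtain rfl : F = 0 := h
    obtain rfl : F' = 0 := h'
    exact residue_zero n
  | succ k ih =>
    intro j n F F' hF hF' h h' hs hk
    obtain _ | j := j
    · obtain rfl : F = 0 := h
      obtain rfl : F' = 0 := h'
      rw [residue_zero, mulZSubW_iterate_zero]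
    by_cases hn : (s : ℤ) ≤ n
    · obtain ⟨i, rfl⟩ : ∃ i : ℕ, n = (i + s : ℕ) := ⟨(n - s).toNat, by omega⟩
      have : residue ((i + s : ℕ) : ℤ) F F' = 0 := by
        ext m r
        rw [residue_natCast _ hF hF', Function.iterate_add_apply, Function.iterate_add_apply, hs,
          sub_self]
        rfl
      rw [this, mulZSubW_iterate_zero]
    · rw [Function.iterate_succ_apply, mulZSubW_residue n hF hF', mul23_eq, mul23_eq,
        residue_sub n hF.mul13 hF'.mul13 hF.mul12 hF'.mul12, residue_mul12 n hF hF',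
        mulZSubW_iterate_sub, ih j n hF.mul13 hF'.mul13 h h' _ (by omega),
        ih (j + 1) (n + 1) hF hF' h h' hs (by omega), sub_zero]
      rw [(commute_mul12_mul13.iterate_left s).eq, (commute_mul12_mul13.iterate_left s).eq, hs]

end Residue

/-! ### Dong's lemma -/

variable {𝔽 V : Type*} [Field 𝔽] [AddCommGroup V] [Module 𝔽 V]

theorem IsLocalPair.symm {A B : VertexOperator 𝔽 V} (h : IsLocalPair A B) : IsLocalPair B A := by
  obtain ⟨N, hN⟩ := h
  refine ⟨N, ?_⟩
  have h1 : (fun m n => ⁅B[[m]], A[[n]]⁆) = fun m n => (fun p q => -⁅A[[p]], B[[q]]⁆) n m := by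
    ext1 m
    ext1 n
    exact (neg_sub _ _).symm
  rw [h1, mulZSubW_iterate_swap]
  have h2 := mulZSubW_iterate_map_eq_zero (-AddMonoidHom.id (Module.End 𝔽 V)) hN
  simp only [AddMonoidHom.neg_apply, AddMonoidHom.id_apply] at h2
  rw [h2]
  ext
  simp

theorem nthProd_ncoeff_apply (A : VertexOperator 𝔽 V) (n : ℤ) (B : VertexOperator 𝔽 V) (m : ℤ)
    (v : V) : ((nthProd A n B)[[m]]) v
      = binomSum n (fun j => (A[[n - j]]) ((B[[m + j]]) v))
        - (n.negOnePow : ℤ) • binomSum n (fun j => (B[[m + n - j]]) ((A[[(j : ℤ)]]) v)) := by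
  obtain ⟨K, hK⟩ := exists_ncoeff_eq_zero A v
  obtain ⟨L, hL⟩ := exists_ncoeff_eq_zero B v
  have h1 : ∀ᶠ j : ℕ in Filter.atTop, (A[[n - j]]) ((B[[m + j]]) v) = 0 := by
    filter_upwards [Filter.eventually_ge_atTop (L - m).toNat] with j hj
    rw [hL _ (by omega), map_zero]
  have h2 : ∀ᶠ j : ℕ in Filter.atTop, (B[[m + n - j]]) ((A[[(j : ℤ)]]) v) = 0 := by
    filter_upwards [Filter.eventually_ge_atTop K.toNat] with j hj
    rw [hK _ (by omega), map_zero]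
  rw [nthProd, ncoeff_ofNCoeff, ← binomSum_zsmul n _ h2,
    ← binomSum_sub n h1 (h2.mono fun j hj => by rw [hj, smul_zero])]
  rfl

/-- **Dong's lemma.** -/
theorem IsLocalPair.nthProd {A B C : VertexOperator 𝔽 V} (hAB : IsLocalPair A B)
    (hAC : IsLocalPair A C) (hBC : IsLocalPair B C) (n : ℤ) :
    IsLocalPair (nthProd A n B) C := by
  obtain ⟨N₁, h₁⟩ := hAB
  obtain ⟨N₂, h₂⟩ := hAC
  obtain ⟨N₃, h₃⟩ := hBC
  obtain ⟨N, hN₁, hN₂, hN₃⟩ : ∃ N, N₁ ≤ N ∧ N₂ ≤ N ∧ N₃ ≤ N :=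
    ⟨N₁ + N₂ + N₃, by omega, by omega, by omega⟩
  replace h₁ := mulZSubW_iterate_eq_zero_of_le hN₁ h₁
  replace h₂ := mulZSubW_iterate_eq_zero_of_le hN₂ h₂
  replace h₃ := mulZSubW_iterate_eq_zero_of_le hN₃ h₃
  -- The last `N` factors `w - u` annihilate `[b(w), c(u)]`; the other `N + (N - n)⁺` are those
  -- required by `mulZSubW_iterate_residue_eq_zero` with `j = s = N`.
  refine ⟨(N + (N - n).toNat) + N, ?_⟩
  ext m r v
  let φ : Module.End 𝔽 V →+ V := (LinearMap.applyₗ (R := 𝔽) (M₂ := V) v).toAddMonoidHom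
  suffices h : mulZSubW^[(N + (N - n).toNat) + N]
      (fun m r => φ ⁅(QuantumField.nthProd A n B)[[m]], C[[r]]⁆) = 0 by
    rw [mulZSubW_iterate_map] at h
    exact congrFun (congrFun h m) r
  -- `F` and `F'` are `[a(z)b(w), c(u)]v` and `[b(w)a(z), c(u)]v`.
  let F : ℤ → ℤ → ℤ → V := fun p q r =>
    (A[[p]]) ((B[[q]]) ((C[[r]]) v)) - (C[[r]]) ((A[[p]]) ((B[[q]]) v))
  let F' : ℤ → ℤ → ℤ → V := fun p q r =>
    (B[[q]]) ((A[[p]]) ((C[[r]]) v)) - (C[[r]]) ((B[[q]]) ((A[[p]]) v))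
  have key : ∀ (X Y : VertexOperator 𝔽 V), mulZSubW^[N] (fun m n => ⁅X[[m]], Y[[n]]⁆) = 0 →
      ∀ (S : Module.End 𝔽 V) (u : V),
        mulZSubW^[N] (fun m n => S ((X[[m]]) ((Y[[n]]) u) - (Y[[n]]) ((X[[m]]) u))) = 0 :=
    fun X Y h S u => mulZSubW_iterate_map_eq_zero
      ((S ∘ₗ LinearMap.applyₗ (R := 𝔽) (M₂ := V) u).toAddMonoidHom) h
  have hF : BoundedSnd F := fun r => by
    obtain ⟨L, hL⟩ := exists_ncoeff_eq_zero B v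
    obtain ⟨L', hL'⟩ := exists_ncoeff_eq_zero B ((C[[r]]) v)
    exact ⟨max L L', fun p q hq => by simp [F, hL q (by omega), hL' q (by omega)]⟩
  have hF' : BoundedFst F' := fun r => by
    obtain ⟨L, hL⟩ := exists_ncoeff_eq_zero A v
    obtain ⟨L', hL'⟩ := exists_ncoeff_eq_zero A ((C[[r]]) v)
    exact ⟨max L L', fun p q hq => by simp [F', hL p (by omega), hL' p (by omega)]⟩
  have hres : (fun m r => φ ⁅(QuantumField.nthProd A n B)[[m]], C[[r]]⁆) = residue n F F' := by
    ext m r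
    obtain ⟨K, hK⟩ := exists_ncoeff_eq_zero A v
    obtain ⟨K', hK'⟩ := exists_ncoeff_eq_zero A ((C[[r]]) v)
    obtain ⟨L, hL⟩ := exists_ncoeff_eq_zero B v
    obtain ⟨L', hL'⟩ := exists_ncoeff_eq_zero B ((C[[r]]) v)
    have e1 : ∀ᶠ j : ℕ in Filter.atTop, (B[[m + j]]) v = 0 := by
      filter_upwards [Filter.eventually_ge_atTop (L - m).toNat] with j hj using hL _ (by omega)
    have e2 : ∀ᶠ j : ℕ in Filter.atTop, (B[[m + j]]) ((C[[r]]) v) = 0 := by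
      filter_upwards [Filter.eventually_ge_atTop (L' - m).toNat] with j hj using hL' _ (by omega)
    have e3 : ∀ᶠ j : ℕ in Filter.atTop, (A[[(j : ℤ)]]) v = 0 := by
      filter_upwards [Filter.eventually_ge_atTop K.toNat] with j hj using hK _ (by omega)
    have e4 : ∀ᶠ j : ℕ in Filter.atTop, (A[[(j : ℤ)]]) ((C[[r]]) v) = 0 := by
      filter_upwards [Filter.eventually_ge_atTop K'.toNat] with j hj using hK' _ (by omega)
    change ((QuantumField.nthProd A n B)[[m]]) ((C[[r]]) v)
      - (C[[r]]) (((QuantumField.nthProd A n B)[[m]]) v) = _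
    have hmap := fun g hg => map_binomSum (C[[r]]).toAddMonoidHom n (g := g) hg
    simp only [LinearMap.toAddMonoidHom_coe] at hmap
    simp only [nthProd_ncoeff_apply, map_sub, map_zsmul, residue, F, F']
    rw [hmap _ (e1.mono fun j hj => by rw [hj, map_zero]),
      hmap _ (e3.mono fun j hj => by rw [hj, map_zero]),
      binomSum_sub n (e2.mono fun j hj => by rw [hj, map_zero])
        (e1.mono fun j hj => by rw [hj, map_zero, map_zero]),
      binomSum_sub n (e4.mono fun j hj => by rw [hj, map_zero])
        (e3.mono fun j hj => by rw [hj, map_zero, map_zero]), smul_sub]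
    abel
  rw [hres, Function.iterate_add_apply, mulZSubW_iterate_residue n hF hF']
  have z1 : ∀ f : ℤ → ℤ → ℤ → V, (mul23 V)^[N] f = 0 → (mul13 V)^[N] ((mul23 V)^[N] f) = 0 :=
    fun f hf => by rw [hf, iterate_map_zero]
  have z2 : ∀ f : ℤ → ℤ → ℤ → V, (mul13 V)^[N] f = 0 → (mul13 V)^[N] ((mul23 V)^[N] f) = 0 :=
    fun f hf => by
      rw [(commute_mul13_mul23.iterate_iterate N N).eq, hf, iterate_map_zero]
  have z3 : ∀ f : ℤ → ℤ → ℤ → V, (mul12 V)^[N] f = 0 → (mul12 V)^[N] ((mul23 V)^[N] f) = 0 :=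
    fun f hf => by
      rw [(commute_mul12_mul23.iterate_iterate N N).eq, hf, iterate_map_zero]
  refine mulZSubW_iterate_residue_eq_zero N _ N n (hF.mul23_iterate N) (hF'.mul23_iterate N)
    ?_ ?_ ?_ le_rfl
  -- `[ab, c] = a[b, c] + [a, c]b`: the first term dies under `(w - u)^N`, the second under `(z -
  -- u)^N`. `F'` is treated in the same way.
  · have hsplit : F = (fun p q r => (A[[p]]) ((B[[q]]) ((C[[r]]) v) - (C[[r]]) ((B[[q]]) v)))
        + fun p q r => (LinearMap.id : Module.End 𝔽 V)
          ((A[[p]]) ((C[[r]]) ((B[[q]]) v)) - (C[[r]]) ((A[[p]]) ((B[[q]]) v))) := by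
      ext p q r
      simp [F]
    rw [hsplit, iterate_map_add, iterate_map_add, z1, z2, add_zero]
    · ext p q r
      rw [mul13_iterate_apply, key A C h₂]
      rfl
    · ext p q r
      rw [mul23_iterate_apply, key B C h₃]
      rfl
  · have hsplit : F' = (fun p q r => (B[[q]]) ((A[[p]]) ((C[[r]]) v) - (C[[r]]) ((A[[p]]) v)))
        + fun p q r => (LinearMap.id : Module.End 𝔽 V)
          ((B[[q]]) ((C[[r]]) ((A[[p]]) v)) - (C[[r]]) ((B[[q]]) ((A[[p]]) v))) := by
      ext p q r
      simp [F']
    rw [hsplit, iterate_map_add, iterate_map_add, z2, z1, add_zero]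
    · ext p q r
      rw [mul23_iterate_apply, key B C h₃]
      rfl
    · ext p q r
      rw [mul13_iterate_apply, key A C h₂]
      rfl
  · rw [← sub_eq_zero, ← iterate_map_sub, ← iterate_map_sub]
    -- `F - F' = [[a(z), b(w)], c(u)]v`, which dies under `(z - w)^N`.
    have hsplit : F - F' = (fun p q r => (LinearMap.id : Module.End 𝔽 V)
          ((A[[p]]) ((B[[q]]) ((C[[r]]) v)) - (B[[q]]) ((A[[p]]) ((C[[r]]) v))))
        - fun p q r => (C[[r]]) ((A[[p]]) ((B[[q]]) v) - (B[[q]]) ((A[[p]]) v)) := by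
      ext p q r
      simp only [F, F', Pi.sub_apply, map_sub, LinearMap.id_apply]
      abel
    rw [hsplit, iterate_map_sub, iterate_map_sub, z3, z3, sub_zero]
    · ext p q r
      rw [mul12_iterate_apply, key A B h₁]
      rfl
    · ext p q r
      rw [mul12_iterate_apply, key A B h₁]
      rfl

variable {𝔽 V : Type*} [Field 𝔽] [AddCommGroup V] [Module 𝔽 V]

theorem ext_ncoeff {A B : VertexOperator 𝔽 V} (h : ∀ n : ℤ, A[[n]] = B[[n]]) : A = B := by
  apply HVertexOperator.coeff_inj
  ext1 n
  rw [VertexOperator.coeff_eq_ncoeff, VertexOperator.coeff_eq_ncoeff, h]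

/-! ### Closure properties of locality -/

theorem IsLocalPair.zero_left (B : VertexOperator 𝔽 V) : IsLocalPair 0 B :=
  ⟨0, by ext; simp [Ring.lie_def]⟩

theorem IsLocalPair.add_left {A A' B : VertexOperator 𝔽 V} (h : IsLocalPair A B)
    (h' : IsLocalPair A' B) : IsLocalPair (A + A') B := by
  obtain ⟨N, hN⟩ := h
  obtain ⟨N', hN'⟩ := h'
  refine ⟨N + N', ?_⟩
  have hsplit : (fun m n => ⁅(A + A')[[m]], B[[n]]⁆)
      = (fun m n => ⁅A[[m]], B[[n]]⁆) + fun m n => ⁅A'[[m]], B[[n]]⁆ := by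
    ext1 m
    ext1 n
    simp only [map_add, Pi.add_apply, Ring.lie_def, add_mul, mul_add]
    abel
  rw [hsplit, mulZSubW_iterate_add, mulZSubW_iterate_eq_zero_of_le (by omega) hN,
    mulZSubW_iterate_eq_zero_of_le (by omega) hN', add_zero]

theorem IsLocalPair.smul_left {A B : VertexOperator 𝔽 V} (r : 𝔽) (h : IsLocalPair A B) :
    IsLocalPair (r • A) B := by
  obtain ⟨N, hN⟩ := h
  refine ⟨N, ?_⟩
  have hr : (fun m n => ⁅(r • A)[[m]], B[[n]]⁆)
      = fun m n => (LinearMap.lsmul 𝔽 (Module.End 𝔽 V) r).toAddMonoidHom ⁅A[[m]], B[[n]]⁆ := by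
    ext m n v
    simp [Ring.lie_def, smul_sub]
  rw [hr]
  exact mulZSubW_iterate_map_eq_zero _ hN

theorem idField_ncoeff (n : ℤ) :
    (idField 𝔽 V)[[n]] = if n = -1 then LinearMap.id else 0 := by
  rw [idField, ncoeff_ofNCoeff]

theorem isLocalPair_idField (B : VertexOperator 𝔽 V) : IsLocalPair (idField 𝔽 V) B := by
  refine ⟨0, ?_⟩
  ext m n v
  by_cases h : m = -1 <;> simp [idField_ncoeff, h, Ring.lie_def]

theorem fieldState_idField (vac : V) : fieldState vac (idField 𝔽 V) = vac := by
  simp [fieldState, idField_ncoeff]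

/-- The derivative `∂_z a(z)`. -/
noncomputable def derivField (A : VertexOperator 𝔽 V) : VertexOperator 𝔽 V :=
  ofNCoeff (fun n => (-n) • A[[n - 1]]) (fun v => by
    obtain ⟨N, hN⟩ := exists_ncoeff_eq_zero A v
    exact ⟨N + 1, fun n hn => by simp [hN (n - 1) (by omega)]⟩)

theorem derivField_ncoeff (A : VertexOperator 𝔽 V) (n : ℤ) :
    (derivField A)[[n]] = (-n) • A[[n - 1]] := by
  rw [derivField, ncoeff_ofNCoeff]

theorem IsLocalPair.derivField {A B : VertexOperator 𝔽 V} (h : IsLocalPair A B) :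
    IsLocalPair (derivField A) B := by
  obtain ⟨N, hN⟩ := h
  refine ⟨N + 1, ?_⟩
  have h1 : (fun m n => ⁅(QuantumField.derivField A)[[m]], B[[n]]⁆)
      = fun m n => (-m) • ⁅A[[m - 1]], B[[n]]⁆ := by
    ext1 m
    ext1 n
    rw [derivField_ncoeff, Ring.lie_def, Ring.lie_def, smul_mul_assoc, mul_smul_comm, smul_sub]
  rw [h1]
  exact mulZSubW_iterate_deriv hN

/-- A field annihilating `|0⟩` annihilates everything obtained from `|0⟩` by fields local to it. -/
theorem IsLocalPair.ncoeff_apply_eq_zero {A B : VertexOperator 𝔽 V} (h : IsLocalPair A B) {v : V}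
    (hv : ∀ m : ℤ, (A[[m]]) v = 0) (m n : ℤ) : (A[[m]]) ((B[[n]]) v) = 0 := by
  obtain ⟨N, hN⟩ := h
  obtain ⟨L, hL⟩ := exists_ncoeff_eq_zero B v
  have h1 := mulZSubW_iterate_map_eq_zero
    (LinearMap.applyₗ (R := 𝔽) (M₂ := V) v).toAddMonoidHom hN
  -- As `A` kills `v`, only `a(z)b(w)v` survives in the commutator. Its powers of `w` are bounded
  -- below, so `(z - w)^N` can be cancelled.
  have h2 : (fun m n => (LinearMap.applyₗ (R := 𝔽) (M₂ := V) v).toAddMonoidHom ⁅A[[m]], B[[n]]⁆)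
      = fun m n => (A[[m]]) ((B[[n]]) v) := by
    ext m n
    simp [Ring.lie_def, hv]
  rw [h2] at h1
  exact congrFun (congrFun (eq_zero_of_mulZSubW_iterate (L := L)
    (fun m n hn => by rw [hL n hn, map_zero]) h1) m) n

/-! ### Closure properties of translation covariance -/

variable {T : Module.End 𝔽 V}

theorem IsTranslationCovariant.apply {A : VertexOperator 𝔽 V} (h : IsTranslationCovariant T A)
    (n : ℤ) (v : V) : T ((A[[n]]) v) = (A[[n]]) (T v) - n • (A[[n - 1]]) v := by
  have h1 := congrArg (fun S : Module.End 𝔽 V => S v) (h n)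
  simp only [Ring.lie_def, LinearMap.sub_apply, Module.End.mul_apply, LinearMap.smul_apply] at h1
  rw [sub_eq_iff_eq_add] at h1
  rw [h1]
  module

theorem isTranslationCovariant_of_apply {A : VertexOperator 𝔽 V}
    (h : ∀ (n : ℤ) (v : V), T ((A[[n]]) v) = (A[[n]]) (T v) - n • (A[[n - 1]]) v) :
    IsTranslationCovariant T A := by
  intro n
  ext v
  simp only [Ring.lie_def, LinearMap.sub_apply, Module.End.mul_apply, LinearMap.smul_apply, h]
  module

theorem IsTranslationCovariant.zero : IsTranslationCovariant T (0 : VertexOperator 𝔽 V) :=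
  isTranslationCovariant_of_apply fun n v => by simp

theorem IsTranslationCovariant.add {A B : VertexOperator 𝔽 V} (hA : IsTranslationCovariant T A)
    (hB : IsTranslationCovariant T B) : IsTranslationCovariant T (A + B) :=
  isTranslationCovariant_of_apply fun n v => by
    simp only [map_add, Pi.add_apply, LinearMap.add_apply, hA.apply, hB.apply]
    module

theorem IsTranslationCovariant.smul {A : VertexOperator 𝔽 V} (r : 𝔽)
    (hA : IsTranslationCovariant T A) : IsTranslationCovariant T (r • A) :=
  isTranslationCovariant_of_apply fun n v => by
    simp only [map_smul, Pi.smul_apply, LinearMap.smul_apply, hA.apply]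
    rw [smul_sub, smul_comm n r]

theorem isTranslationCovariant_idField : IsTranslationCovariant T (idField 𝔽 V) :=
  isTranslationCovariant_of_apply fun n v => by
    rw [idField_ncoeff, idField_ncoeff]
    by_cases h : n = -1
    · simp [h]
    · by_cases h0 : n = 0
      · simp [h0]
      · rw [if_neg h, if_neg (by omega)]
        simp

theorem IsTranslationCovariant.derivField {A : VertexOperator 𝔽 V}
    (hA : IsTranslationCovariant T A) : IsTranslationCovariant T (derivField A) :=
  isTranslationCovariant_of_apply fun n v => by
    simp only [derivField_ncoeff, LinearMap.smul_apply, map_zsmul, hA.apply]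
    module

/-- `[T, ·]` acts on `a(z)b(w)` and `b(w)a(z)` as `∂_z + ∂_w`, which annihilates both expansions of
`(z - w)ⁿ`; after `Res_z` only `∂_w` of the product remains. -/
theorem IsTranslationCovariant.nthProd {A B : VertexOperator 𝔽 V}
    (hA : IsTranslationCovariant T A) (hB : IsTranslationCovariant T B) (n : ℤ) :
    IsTranslationCovariant T (nthProd A n B) := by
  refine isTranslationCovariant_of_apply fun m v => ?_
  obtain ⟨K, hK⟩ := exists_ncoeff_eq_zero A v
  obtain ⟨K', hK'⟩ := exists_ncoeff_eq_zero A (T v)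
  obtain ⟨L, hL⟩ := exists_ncoeff_eq_zero B v
  obtain ⟨L', hL'⟩ := exists_ncoeff_eq_zero B (T v)
  have e1 : ∀ k : ℤ, ∀ᶠ j : ℕ in Filter.atTop, (B[[k + j]]) v = 0 := fun k => by
    filter_upwards [Filter.eventually_ge_atTop (L - k).toNat] with j hj using hL _ (by omega)
  have e2 : ∀ k : ℤ, ∀ᶠ j : ℕ in Filter.atTop, (B[[k + j]]) (T v) = 0 := fun k => by
    filter_upwards [Filter.eventually_ge_atTop (L' - k).toNat] with j hj using hL' _ (by omega)
  have e3 : ∀ᶠ j : ℕ in Filter.atTop, (A[[(j : ℤ)]]) v = 0 := by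
    filter_upwards [Filter.eventually_ge_atTop K.toNat] with j hj using hK _ (by omega)
  have e3' : ∀ᶠ j : ℕ in Filter.atTop, (A[[(j : ℤ) - 1]]) v = 0 := by
    filter_upwards [Filter.eventually_ge_atTop (K + 1).toNat] with j hj using hK _ (by omega)
  have e4 : ∀ᶠ j : ℕ in Filter.atTop, (A[[(j : ℤ)]]) (T v) = 0 := by
    filter_upwards [Filter.eventually_ge_atTop K'.toNat] with j hj using hK' _ (by omega)
  have hmap := fun g hg => map_binomSum T.toAddMonoidHom n (g := g) hg
  simp only [LinearMap.toAddMonoidHom_coe] at hmap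
  have f1 := (e1 m).mono fun j hj =>
    show (A[[n - j]]) ((B[[m + j]]) v) = 0 by rw [hj, map_zero]
  have f1' := (e1 (m - 1)).mono fun j hj =>
    show (A[[n - j]]) ((B[[m - 1 + j]]) v) = 0 by rw [hj, map_zero]
  have f2 := (e2 m).mono fun j hj =>
    show (A[[n - j]]) ((B[[m + j]]) (T v)) = 0 by rw [hj, map_zero]
  have f3 := e3.mono fun j hj =>
    show (B[[m + n - j]]) ((A[[(j : ℤ)]]) v) = 0 by rw [hj, map_zero]
  have f3' := e3.mono fun j hj =>
    show (B[[m - 1 + n - j]]) ((A[[(j : ℤ)]]) v) = 0 by rw [hj, map_zero]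
  have f3'' := e3'.mono fun j hj =>
    show (B[[m + n - j]]) ((A[[(j : ℤ) - 1]]) v) = 0 by rw [hj, map_zero]
  have f4 := e4.mono fun j hj =>
    show (B[[m + n - j]]) ((A[[(j : ℤ)]]) (T v)) = 0 by rw [hj, map_zero]
  have s1 : T (binomSum n fun j => (A[[n - j]]) ((B[[m + j]]) v))
      = binomSum n (fun j => (A[[n - j]]) ((B[[m + j]]) (T v)))
        - m • binomSum n (fun j => (A[[n - j]]) ((B[[m - 1 + j]]) v)) := by
    have g := f1'.mono fun j hj =>
      show m • (A[[n - j]]) ((B[[m - 1 + j]]) v) = 0 by rw [hj, smul_zero]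
    rw [hmap _ f1, ← binomSum_zsmul n m f1', ← binomSum_sub n f2 g]
    refine .trans ?_ (binomSum_sub_deriv n
      (by filter_upwards [f2, g] with j h1 h2 using by rw [h1, h2, sub_zero]) f1')
    congr 1
    ext j
    rw [hA.apply, hB.apply, map_sub, map_zsmul,
      show m + (j : ℤ) - 1 = m - 1 + j by ring,
      show m - 1 + ((j + 1 : ℕ) : ℤ) = m + j by push_cast; ring,
      show n - ((j + 1 : ℕ) : ℤ) = n - j - 1 by push_cast; ring]
    module
  have s2 : T (binomSum n fun j => (B[[m + n - j]]) ((A[[(j : ℤ)]]) v))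
      = binomSum n (fun j => (B[[m + n - j]]) ((A[[(j : ℤ)]]) (T v)))
        - m • binomSum n (fun j => (B[[m - 1 + n - j]]) ((A[[(j : ℤ)]]) v)) := by
    have g := f3'.mono fun j hj =>
      show m • (B[[m - 1 + n - j]]) ((A[[(j : ℤ)]]) v) = 0 by rw [hj, smul_zero]
    rw [hmap _ f3, ← binomSum_zsmul n m f3', ← binomSum_sub n f4 g]
    -- Here `g j` contains `A[[j - 1]]`; the possibly nonzero entry `A[[-1]]` at `j = 0` carries the
    -- weight `j = 0`.
    refine .trans ?_ (binomSum_sub_deriv n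
      (by filter_upwards [f4, g] with j h1 h2 using by rw [h1, h2, sub_zero]) f3'')
    congr 1
    ext j
    rw [hB.apply, hA.apply, map_sub, map_zsmul,
      show m + n - ((j + 1 : ℕ) : ℤ) = m - 1 + n - j by push_cast; ring,
      show m + n - (j : ℤ) - 1 = m - 1 + n - j by ring,
      show ((j + 1 : ℕ) : ℤ) - 1 = j by push_cast; ring]
    module
  simp only [nthProd_ncoeff_apply, map_sub, map_zsmul, s1, s2]
  module

/-! ### The action of covariant fields on the vacuum -/

section Vacuum

variable {vac : V} {A : VertexOperator 𝔽 V}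

theorem IsTranslationCovariant.apply_vac (hA : IsTranslationCovariant T A) (hvac : T vac = 0)
    (n : ℤ) : T ((A[[n]]) vac) = (-n) • (A[[n - 1]]) vac := by
  rw [hA.apply, hvac, map_zero]
  module

variable [CharZero 𝔽]

/-- Characteristic 0 enters here, through division by `n`. -/
theorem IsTranslationCovariant.ncoeff_pred_vac (hA : IsTranslationCovariant T A)
    (hvac : T vac = 0) {n : ℤ} (hn : n ≠ 0) (h : (A[[n]]) vac = 0) : (A[[n - 1]]) vac = 0 := by
  have h1 := hA.apply_vac hvac n
  rw [h, map_zero, ← Int.cast_smul_eq_zsmul 𝔽] at h1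
  exact (smul_eq_zero.1 h1.symm).resolve_left (by simpa using hn)

/-- Descent from large indices, where a field vanishes on `|0⟩`. It stops at index 0, since the step
to `-1` would divide by 0. -/
theorem IsTranslationCovariant.ncoeff_vac (hA : IsTranslationCovariant T A) (hvac : T vac = 0)
    {n : ℤ} (hn : 0 ≤ n) : (A[[n]]) vac = 0 := by
  obtain ⟨N, hN⟩ := exists_ncoeff_eq_zero A vac
  have key : ∀ (k : ℕ) (n : ℤ), 0 ≤ n → N ≤ n + k → (A[[n]]) vac = 0 := by
    intro k
    induction k with
    | zero => exact fun n _ h => hN n (by simpa using h)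
    | succ k ih =>
      intro n hn h
      have := hA.ncoeff_pred_vac hvac (n := n + 1) (by omega)
        (ih (n + 1) (by omega) (by push_cast at h; omega))
      simpa using this
  exact key (N - n).toNat n hn (by omega)

/-- The hypothesis on the state bridges the gap at index `-1`, and the descent resumes from there.
-/
theorem IsTranslationCovariant.ncoeff_vac_eq_zero (hA : IsTranslationCovariant T A)
    (hvac : T vac = 0) (h : fieldState vac A = 0) (n : ℤ) : (A[[n]]) vac = 0 := by
  by_cases hn : 0 ≤ n
  · exact hA.ncoeff_vac hvac hn
  have key : ∀ k : ℕ, (A[[-1 - (k : ℤ)]]) vac = 0 := by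
    intro k
    induction k with
    | zero => simpa [fieldState] using h
    | succ k ih =>
      have := hA.ncoeff_pred_vac hvac (by omega) ih
      rwa [show -1 - (k : ℤ) - 1 = -1 - (k + 1 : ℕ) by push_cast; ring] at this
  have := key (-1 - n).toNat
  rwa [show -1 - ((-1 - n).toNat : ℤ) = n by omega] at this

/-- On `|0⟩`, nonnegative modes vanish: the first sum keeps only `j = 0`, and the second disappears.
-/
theorem fieldState_nthProd (hA : IsTranslationCovariant T A) (hvac : T vac = 0)
    {B : VertexOperator 𝔽 V} (hB : IsTranslationCovariant T B) (n : ℤ) :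
    fieldState vac (nthProd A n B) = (A[[n]]) (fieldState vac B) := by
  rw [fieldState, nthProd_ncoeff_apply, binomSum_eq_apply_zero n fun j => by
      rw [hB.ncoeff_vac hvac (by push_cast; omega), map_zero],
    binomSum_eq_apply_zero n fun j => by
      rw [hA.ncoeff_vac hvac (by omega), map_zero] ]
  simp only [Nat.cast_zero, hA.ncoeff_vac hvac le_rfl, map_zero, smul_zero, sub_zero, add_zero]
  rfl

end Vacuum

end QuantumField

/-! ### The spaces `Fmin` and `Fmax` -/

namespace PreVertexAlgebra

variable {𝔽 V J : Type*} [Field 𝔽] [AddCommGroup V] [Module 𝔽 V] (P : PreVertexAlgebra 𝔽 V J)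

/-- `Fmax` as a subspace. -/
def FmaxSubmodule : Submodule 𝔽 (VertexOperator 𝔽 V) where
  carrier := P.Fmax
  zero_mem' := ⟨.zero, fun j => .zero_left (P.field j)⟩
  add_mem' hA hB := ⟨hA.1.add hB.1, fun j => (hA.2 j).add_left (hB.2 j)⟩
  smul_mem' r _ hA := ⟨hA.1.smul r, fun j => (hA.2 j).smul_left r⟩

theorem field_mem_Fmax (j : J) : P.field j ∈ P.Fmax :=
  ⟨P.translation_covariance j, P.locality j⟩

theorem idField_mem_Fmax : idField 𝔽 V ∈ P.Fmax :=
  ⟨isTranslationCovariant_idField, fun j => isLocalPair_idField (P.field j)⟩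

variable {P}

theorem nthProd_mem_Fmax {A : VertexOperator 𝔽 V} (hA : A ∈ P.Fmax) (j : J) (n : ℤ) :
    nthProd (P.field j) n A ∈ P.Fmax :=
  ⟨(P.translation_covariance j).nthProd hA.1 n,
    fun k => (hA.2 j).symm.nthProd (P.locality j k) (hA.2 k) n⟩

theorem derivField_mem_Fmax {A : VertexOperator 𝔽 V} (hA : A ∈ P.Fmax) : derivField A ∈ P.Fmax :=
  ⟨hA.1.derivField, fun j => (hA.2 j).derivField⟩

variable (P)

theorem foldr_nthProd_mem_Fmax (l : List (J × ℤ)) :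
    l.foldr (fun p B => nthProd (P.field p.1) p.2 B) (idField 𝔽 V) ∈ P.Fmax := by
  induction l with
  | nil => exact P.idField_mem_Fmax
  | cons p l ih => exact nthProd_mem_Fmax ih p.1 p.2

theorem Fmin_le_FmaxSubmodule : P.Fmin ≤ P.FmaxSubmodule :=
  Submodule.span_le.2 (by rintro _ ⟨l, rfl⟩; exact P.foldr_nthProd_mem_Fmax l)

variable {P}

/-- Membership in `Fmax` gives locality only with the generators. Dong's lemma, by induction on the
construction of `A`, extends it to every field of `Fmin`. -/
theorem isLocalPair_of_mem_Fmin {A B : VertexOperator 𝔽 V} (hA : A ∈ P.Fmin) (hB : B ∈ P.Fmax) :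
    IsLocalPair A B := by
  induction hA using Submodule.span_induction with
  | mem _ h =>
    obtain ⟨l, rfl⟩ := h
    induction l with
    | nil => exact isLocalPair_idField B
    | cons p l ih =>
      exact ((P.foldr_nthProd_mem_Fmax l).2 p.1).symm.nthProd (hB.2 p.1).symm ih p.2
  | zero => exact .zero_left B
  | add _ _ _ _ h h' => exact h.add_left h'
  | smul r _ _ h => exact h.smul_left r

/-! ### Uniqueness and existence of a field with given state -/

variable [CharZero 𝔽]

/-- Goddard's uniqueness theorem. -/
theorem eq_zero_of_fieldState_eq_zero {A : VertexOperator 𝔽 V} (hA : A ∈ P.Fmax)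
    (h : fieldState P.vac A = 0) : A = 0 := by
  have hvac := hA.1.ncoeff_vac_eq_zero P.vacuum h
  have hfold : ∀ (l : List (J × ℤ)) (m : ℤ),
      (A[[m]]) (l.foldr (fun p v => ((P.field p.1)[[p.2]]) v) P.vac) = 0 := by
    intro l
    induction l with
    | nil => exact hvac
    | cons p l ih => exact fun m => (hA.2 p.1).ncoeff_apply_eq_zero ih m p.2
  refine ext_ncoeff fun n => ?_
  rw [map_zero, Pi.zero_apply]
  refine LinearMap.ext_on_range P.completeness fun l => ?_
  rw [hfold l n, LinearMap.zero_apply]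

theorem eq_of_fieldState_eq {A B : VertexOperator 𝔽 V} (hA : A ∈ P.Fmax) (hB : B ∈ P.Fmax)
    (h : fieldState P.vac A = fieldState P.vac B) : A = B := by
  refine sub_eq_zero.1 (eq_zero_of_fieldState_eq_zero (P := P) (P.FmaxSubmodule.sub_mem hA hB) ?_)
  simp only [fieldState] at h ⊢
  rw [map_sub, Pi.sub_apply, LinearMap.sub_apply, h, sub_self]

variable (P)

theorem fieldState_foldr_nthProd (l : List (J × ℤ)) :
    fieldState P.vac (l.foldr (fun p B => nthProd (P.field p.1) p.2 B) (idField 𝔽 V))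
      = l.foldr (fun p v => ((P.field p.1)[[p.2]]) v) P.vac := by
  induction l with
  | nil => exact fieldState_idField P.vac
  | cons p l ih =>
    rw [List.foldr_cons, List.foldr_cons, ← ih]
    exact fieldState_nthProd (P.translation_covariance p.1) P.vacuum
      (P.foldr_nthProd_mem_Fmax l).1 p.2

theorem exists_mem_Fmin_fieldState_eq (v : V) : ∃ A ∈ P.Fmin, fieldState P.vac A = v := by
  have hv : v ∈ Submodule.span 𝔽 (Set.range fun l : List (J × ℤ) =>
      l.foldr (fun p v => ((P.field p.1)[[p.2]]) v) P.vac) := P.completeness ▸ Submodule.mem_top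
  induction hv using Submodule.span_induction with
  | mem _ h =>
    obtain ⟨l, rfl⟩ := h
    exact ⟨_, Submodule.subset_span ⟨l, rfl⟩, P.fieldState_foldr_nthProd l⟩
  | zero => exact ⟨0, zero_mem _, by simp [fieldState]⟩
  | add _ _ _ _ h h' =>
    obtain ⟨A, hA, rfl⟩ := h
    obtain ⟨B, hB, rfl⟩ := h'
    exact ⟨A + B, add_mem hA hB, by simp [fieldState]⟩
  | smul r _ _ h =>
    obtain ⟨A, hA, rfl⟩ := h
    exact ⟨r • A, Submodule.smul_mem _ r hA, by simp [fieldState]⟩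

/-- A field of `Fmax` shares its state with some field of `Fmin`, and uniqueness in `Fmax`
identifies them. -/
theorem coe_Fmin_eq_Fmax : (P.Fmin : Set (VertexOperator 𝔽 V)) = P.Fmax := by
  refine Set.Subset.antisymm P.Fmin_le_FmaxSubmodule fun A hA => ?_
  obtain ⟨B, hB, h⟩ := P.exists_mem_Fmin_fieldState_eq (fieldState P.vac A)
  rw [← eq_of_fieldState_eq (P.Fmin_le_FmaxSubmodule hB) hA h]
  exact hB

theorem fs_bijective : Function.Bijective P.fs := by
  refine ⟨fun A B h => Subtype.ext (eq_of_fieldState_eq A.2 B.2 h), fun v => ?_⟩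
  obtain ⟨A, hA, h⟩ := P.exists_mem_Fmin_fieldState_eq v
  exact ⟨⟨A, P.Fmin_le_FmaxSubmodule hA⟩, h⟩

/-! ### The state-field correspondence -/

/-- The restriction of the field-state map to `FmaxSubmodule`. -/
noncomputable def fsLinearMap : P.FmaxSubmodule →ₗ[𝔽] V where
  toFun A := fieldState P.vac (A : VertexOperator 𝔽 V)
  map_add' A B := by simp [fieldState]
  map_smul' r A := by simp [fieldState]

/-- `fs` as a linear isomorphism. -/
noncomputable def fsEquiv : P.FmaxSubmodule ≃ₗ[𝔽] V :=
  LinearEquiv.ofBijective P.fsLinearMap P.fs_bijective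

/-- The state-field correspondence, inverse to `fs`. -/
noncomputable def sf : V →ₗ[𝔽] VertexOperator 𝔽 V :=
  P.FmaxSubmodule.subtype ∘ₗ P.fsEquiv.symm.toLinearMap

theorem sf_mem_Fmax (a : V) : P.sf a ∈ P.Fmax :=
  Subtype.property (p := (· ∈ P.FmaxSubmodule)) _

theorem fieldState_sf (a : V) : fieldState P.vac (P.sf a) = a :=
  P.fsEquiv.apply_symm_apply a

variable {P} in
-- Reduces identities between fields of `Fmax` to identities between their states.
theorem sf_eq {A : VertexOperator 𝔽 V} (hA : A ∈ P.Fmax) {a : V} (h : fieldState P.vac A = a) :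
    P.sf a = A :=
  eq_of_fieldState_eq (P.sf_mem_Fmax a) hA (by rw [fieldState_sf, h])

/-- The state of `∂_z a(z)` is `a₍₋₂₎|0⟩`, which is `Ta` by covariance at `n = -1`. -/
theorem sf_T (a : V) : P.sf (P.T a) = derivField (P.sf a) := by
  refine sf_eq (derivField_mem_Fmax (P.sf_mem_Fmax a)) ?_
  have h := (P.sf_mem_Fmax a).1.apply_vac P.vacuum (-1)
  have h1 := P.fieldState_sf a
  rw [fieldState] at h1 ⊢
  rw [derivField_ncoeff, LinearMap.smul_apply, ← h, h1]

theorem isLocalPair_sf (a b : V) : IsLocalPair (P.sf a) (P.sf b) :=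
  isLocalPair_of_mem_Fmin (by
    rw [← SetLike.mem_coe, coe_Fmin_eq_Fmax]
    exact P.sf_mem_Fmax a) (P.sf_mem_Fmax b)

theorem sf_vac : P.sf P.vac = idField 𝔽 V :=
  sf_eq P.idField_mem_Fmax (fieldState_idField P.vac)

theorem isVertexAlgebra_sf : IsVertexAlgebra P.vac P.T P.sf where
  vac_ne_zero := P.vac_ne_zero
  vacuum_field := P.sf_vac
  creation_regular a _ hn := (P.sf_mem_Fmax a).1.ncoeff_vac P.vacuum hn
  creation_zero := P.fieldState_sf
  creation_one a := by
    have h := (P.sf_mem_Fmax a).1.apply_vac P.vacuum (-1)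
    have h1 := P.fieldState_sf a
    rw [fieldState] at h1
    rw [h1] at h
    rw [h]
    norm_num
  translation_covariance a := (P.sf_mem_Fmax a).1
  locality := P.isLocalPair_sf

theorem isLocalUnitalZAlgebra_sf : IsLocalUnitalZAlgebra P.vac P.T P.sf where
  derivation a b n := by
    -- Since `(Ta)(z) = ∂_z a(z)`, the derivation property is covariance of `a(z)` applied to `b`.
    rw [sf_T, derivField_ncoeff, (P.sf_mem_Fmax a).1.apply, LinearMap.smul_apply]
    module
  consistency a n := by rw [sf_T, derivField_ncoeff]
  unit_ne_zero := P.vac_ne_zero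
  unit_left := P.sf_vac
  unit_right_regular := P.isVertexAlgebra_sf.creation_regular
  unit_right_zero := P.fieldState_sf
  locality := P.isLocalPair_sf

end PreVertexAlgebra

theorem theorem1p1 {𝔽 V J : Type*} [Field 𝔽] [CharZero 𝔽] [AddCommGroup V] [Module 𝔽 V]
    (P : PreVertexAlgebra 𝔽 V J) :
    (P.Fmin : Set (VertexOperator 𝔽 V)) = P.Fmax ∧
    (∀ A ∈ P.Fmax, ∀ n : ℤ, 0 ≤ n → (A[[n]]) P.vac = 0) ∧
    ∃ hfs : Function.Bijective P.fs,
      ∃ Y : V →ₗ[𝔽] VertexOperator 𝔽 V,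
        (∀ a : V, Y a = ((Equiv.ofBijective P.fs hfs).symm a : VertexOperator 𝔽 V)) ∧
        IsVertexAlgebra P.vac P.T Y ∧
        IsLocalUnitalZAlgebra P.vac P.T Y ∧
        ∀ j : J, Y (QuantumField.fieldState P.vac (P.field j)) = P.field j :=
  ⟨P.coe_Fmin_eq_Fmax, fun _ hA _ hn => hA.1.ncoeff_vac P.vacuum hn, P.fs_bijective, P.sf,
    fun a => PreVertexAlgebra.sf_eq (Subtype.property _)
      ((Equiv.ofBijective P.fs P.fs_bijective).apply_symm_apply a),
    P.isVertexAlgebra_sf, P.isLocalUnitalZAlgebra_sf,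
    fun j => PreVertexAlgebra.sf_eq (P.field_mem_Fmax j) rfl⟩
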